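/- A \emph{coloring} of a finite simple graph $G$ is a labeling of its vertices; it is \emph{proper} if adjacent vertices always receive different labels, and \emph{distinguishing} if no nontrivial automorphism of $G$ preserves all of the vertex colors. The \emph{distinguishing chromatic number} $\chi_D(G)$ is the minimum number of colors in a coloring of $G$ that is both proper and distinguishing. The \emph{list distinguishing chromatic number} $\chi_{D_\ell}(G)$ is the minimum integer $k$ such that, for every assignment $L=\{L(v)\}_{v\in V(G)}$ of finite lists of colors with $|L(v)|\ge k$ for all $v$, there is a proper distinguishing coloring $f$ of $G$ with $f(v)\in L(v)$ for all $v\in V(G)$. \textbf{Theorem.} For every finite tree $T$, $\chi_D(T)=\chi_{D_\ell}(T)$. -/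

import Mathlib

namespace SimpleGraph

variable {V : Type*} {α : Type*}

/-- A coloring `φ` of the vertices of `G` is distinguishing if the only automorphism of `G` that
preserves all vertex colors is the identity. -/
def IsDistinguishing (G : SimpleGraph V) (φ : V → α) : Prop :=
  ∀ σ : G ≃g G, (∀ v, φ (σ v) = φ v) → σ = RelIso.refl G.Adj

/-- `G` has a proper coloring with colors from a set of `k` colors that is distinguishing. -/
def ProperlyDistinguishable (G : SimpleGraph V) (k : ℕ) : Prop :=
  ∃ C : G.Coloring (Fin k), G.IsDistinguishing C

/-- `G` is properly `L`-distinguishable: it has a proper distinguishing coloring in which every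
vertex `v` receives a color from its list `L v`. -/
def ProperlyListDistinguishable (G : SimpleGraph V) (L : V → Finset ℕ) : Prop :=
  ∃ C : G.Coloring ℕ, G.IsDistinguishing C ∧ ∀ v, C v ∈ L v

/-- The distinguishing chromatic number `χ_D(G)`: the minimum number of colors in a proper
distinguishing coloring of `G`. -/
noncomputable def distChromaticNumber (G : SimpleGraph V) : ℕ :=
  sInf {k | G.ProperlyDistinguishable k}

/-- The list distinguishing chromatic number `χ_{D_ℓ}(G)`: the minimum `k` such that `G` is
properly `L`-distinguishable for every assignment `L` of lists of at least `k` colors. -/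
noncomputable def listDistChromaticNumber (G : SimpleGraph V) : ℕ :=
  sInf {k | ∀ L : V → Finset ℕ, (∀ v, k ≤ (L v).card) → G.ProperlyListDistinguishable L}

/-- An injective coloring is distinguishing. -/
theorem isDistinguishing_of_injective (G : SimpleGraph V) {φ : V → α}
    (h : Function.Injective φ) : G.IsDistinguishing φ :=
  fun _ hσ => RelIso.ext fun v => h (hσ v)

/-- For a finite graph the minimum defining `distChromaticNumber` is attained. -/
theorem isLeast_distChromaticNumber [Finite V] (G : SimpleGraph V) :
    IsLeast {k | G.ProperlyDistinguishable k} G.distChromaticNumber := by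
  have hne : {k | G.ProperlyDistinguishable k}.Nonempty :=
    ⟨Nat.card V, Coloring.mk (Finite.equivFin V) fun h => (Finite.equivFin V).injective.ne h.ne,
      G.isDistinguishing_of_injective (Finite.equivFin V).injective⟩
  exact ⟨Nat.sInf_mem hne, fun _ hk => Nat.sInf_le hk⟩

/-- For a finite graph the minimum defining `listDistChromaticNumber` is attained. -/
theorem isLeast_listDistChromaticNumber [Finite V] (G : SimpleGraph V) :
    IsLeast {k | ∀ L : V → Finset ℕ, (∀ v, k ≤ (L v).card) → G.ProperlyListDistinguishable L}
      G.listDistChromaticNumber := by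
  have hne : {k | ∀ L : V → Finset ℕ, (∀ v, k ≤ (L v).card) →
      G.ProperlyListDistinguishable L}.Nonempty := by
    refine ⟨Nat.card V, fun L hL => ?_⟩
    obtain ⟨f, hf, hfL⟩ := (Finset.all_card_le_biUnion_card_iff_exists_injective L).1 (by
      intro s
      rcases s.eq_empty_or_nonempty with rfl | ⟨v, hv⟩
      · simp
      · have := Fintype.ofFinite V
        calc s.card ≤ Nat.card V := by
              rw [Nat.card_eq_fintype_card]; exact s.card_le_univ
          _ ≤ (L v).card := hL v
          _ ≤ _ := Finset.card_le_card (Finset.subset_biUnion_of_mem L hv))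
    exact ⟨Coloring.mk f fun h => hf.ne h.ne, G.isDistinguishing_of_injective hf, hfL⟩
  exact ⟨Nat.sInf_mem hne, fun _ hk => Nat.sInf_le hk⟩

end SimpleGraph

/-! ### Counting sets of distinct representatives -/

section Representatives

open Finset

/-! Every automorphism fixes a center `r` of the tree or moves it to a neighbor, so one that
preserves a proper coloring fixes `r`. With root `r`, a proper coloring is therefore distinguishing
iff siblings always carry non-isomorphic colored subtrees (`siblingsDiffer_of_isDistinguishing`,
`eq_refl_of_siblingsDiffer`).

Such colorings, up to isomorphism of colored rooted trees, are counted by codes. Once `v` has color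
`c`, its code amounts to a set of distinct codes, one for each child and with a root color other
than `c`: a set of distinct representatives. Children of different shapes have disjoint sets of
codes; under constant lists, children of equal shape have equal ones. By
`card_transversals_le_card_transversals` this pattern minimizes the number of such sets. Induction
from the leaves (`card_listCodes_const_le`) then shows that if a code exists for `k` colors, one
exists for any lists of size at least `k`. The converse inequality is the special case of constant
lists. -/

open scoped Classical in
/-- The sets of distinct representatives of the family `A` indexed by `W`. -/
noncomputable def transversals {ι : Type*} (W : Finset ι) (A : ι → Finset ℕ) :
    Finset (Finset ℕ) :=
  (W.biUnion A).powerset.filter fun s =>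
    ∃ g : ι → ℕ, Set.InjOn g W ∧ (∀ w ∈ W, g w ∈ A w) ∧ W.image g = s

section Transversals

variable {ι : Type*} {W : Finset ι} {A B : ι → Finset ℕ} {s : Finset ℕ}

theorem mem_transversals : s ∈ transversals W A ↔
    ∃ g : ι → ℕ, Set.InjOn g W ∧ (∀ w ∈ W, g w ∈ A w) ∧ W.image g = s := by
  classical
  simp only [transversals, mem_filter, mem_powerset, and_iff_right_iff_imp]
  rintro ⟨g, -, hg, rfl⟩
  intro x hx
  obtain ⟨w, hw, rfl⟩ := mem_image.1 hx
  exact mem_biUnion.2 ⟨w, hw, hg w hw⟩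

theorem transversals_congr (h : ∀ w ∈ W, A w = B w) :
    transversals W A = transversals W B := by
  ext s
  simp only [mem_transversals]
  refine exists_congr fun g => and_congr_right fun _ => and_congr_left fun _ => ?_
  exact forall₂_congr fun w hw => by rw [h w hw]

theorem notMem_of_mem_transversals_erase {x : ℕ}
    (hs : s ∈ transversals W fun w => (A w).erase x) : x ∉ s := by
  obtain ⟨g, -, hg, rfl⟩ := mem_transversals.1 hs
  intro hx
  obtain ⟨w, hw, h⟩ := mem_image.1 hx
  exact (mem_erase.1 (hg w hw)).1 h

/-- Adding `x` as the representative of `w₀` turns the first family injectively into sets that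
contain `x`, while the second family avoids `x`. -/
theorem card_transversals_erase_add_le [DecidableEq ι] {w₀ : ι} (hw₀ : w₀ ∈ W) {x : ℕ}
    (hx : x ∈ A w₀) :
    #(transversals (W.erase w₀) fun w => (A w).erase x) +
      #(transversals W fun w => (A w).erase x) ≤ #(transversals W A) := by
  have hinj : Set.InjOn (insert x)
      (transversals (W.erase w₀) fun w => (A w).erase x : Set (Finset ℕ)) := by
    intro s hs s' hs' h
    rw [← erase_insert (notMem_of_mem_transversals_erase hs),
      ← erase_insert (notMem_of_mem_transversals_erase hs')]
    exact congrArg (fun t => t.erase x) h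
  rw [← card_image_of_injOn hinj, ← card_union_of_disjoint]
  · refine card_le_card (union_subset ?_ ?_)
    · intro t ht
      obtain ⟨s, hs, rfl⟩ := mem_image.1 ht
      obtain ⟨g, hgi, hg, rfl⟩ := mem_transversals.1 hs
      refine mem_transversals.2 ⟨Function.update g w₀ x, ?_, ?_, ?_⟩
      · intro a ha b hb hab
        by_cases h1 : a = w₀ <;> by_cases h2 : b = w₀
        · rw [h1, h2]
        · subst h1
          rw [Function.update_self, Function.update_of_ne h2] at hab
          exact absurd hab.symm (mem_erase.1 (hg b (mem_erase.2 ⟨h2, hb⟩))).1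
        · subst h2
          rw [Function.update_self, Function.update_of_ne h1] at hab
          exact absurd hab (mem_erase.1 (hg a (mem_erase.2 ⟨h1, ha⟩))).1
        · rw [Function.update_of_ne h1, Function.update_of_ne h2] at hab
          exact hgi (mem_erase.2 ⟨h1, ha⟩) (mem_erase.2 ⟨h2, hb⟩) hab
      · intro w hw
        by_cases h : w = w₀
        · subst h; rwa [Function.update_self]
        · rw [Function.update_of_ne h]
          exact (mem_erase.1 (hg w (mem_erase.2 ⟨h, hw⟩))).2
      · conv_lhs => rw [← insert_erase hw₀]
        rw [image_insert, Function.update_self]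
        congr 1
        exact image_congr fun w hw => Function.update_of_ne (mem_erase.1 hw).1 _ _
    · intro s hs
      obtain ⟨g, hgi, hg, rfl⟩ := mem_transversals.1 hs
      exact mem_transversals.2 ⟨g, hgi, fun w hw => (mem_erase.1 (hg w hw)).2, rfl⟩
  · rw [Finset.disjoint_left]
    intro t ht ht'
    obtain ⟨s, hs, rfl⟩ := mem_image.1 ht
    exact notMem_of_mem_transversals_erase ht' (mem_insert_self _ _)

/-- If `y` represents some `w₁`, then `B w₁ = B w₀`, so the representatives of `w₀` and `w₁` can be
swapped: `y` may be assumed to represent `w₀`. -/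
theorem card_transversals_le_erase_add [DecidableEq ι] {w₀ : ι} (hw₀ : w₀ ∈ W) {y : ℕ}
    (hy : ∀ w ∈ W, y ∈ B w → B w = B w₀) :
    #(transversals W B) ≤ #(transversals (W.erase w₀) fun w => (B w).erase y) +
      #(transversals W fun w => (B w).erase y) := by
  refine le_trans (card_le_card (t := (transversals (W.erase w₀) fun w => (B w).erase y).image
    (insert y) ∪ transversals W fun w => (B w).erase y) ?_)
    ((card_union_le _ _).trans (Nat.add_le_add_right card_image_le _))
  intro s hs
  obtain ⟨g, hgi, hg, rfl⟩ := mem_transversals.1 hs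
  by_cases hys : y ∈ W.image g
  · obtain ⟨w₁, hw₁, rfl⟩ := mem_image.1 hys
    have hB := hy w₁ hw₁ (hg w₁ hw₁)
    have hmaps : ∀ w ∈ W, Equiv.swap w₀ w₁ w ∈ W := by
      intro w hw
      rw [Equiv.swap_apply_def]
      split_ifs <;> assumption
    have hinj : Set.InjOn (g ∘ Equiv.swap w₀ w₁) W := fun a ha b hb hab =>
      (Equiv.swap w₀ w₁).injective (hgi (hmaps a ha) (hmaps b hb) hab)
    have himg : W.image (g ∘ Equiv.swap w₀ w₁) = W.image g := by
      rw [← image_image]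
      congr 1
      refine Finset.eq_of_subset_of_card_le (fun x hx => ?_) ?_
      · obtain ⟨w, hw, rfl⟩ := mem_image.1 hx
        exact hmaps w hw
      · rw [card_image_of_injective _ (Equiv.swap w₀ w₁).injective]
    have hval : (g ∘ Equiv.swap w₀ w₁) w₀ = g w₁ := by simp
    refine mem_union_left _ (mem_image.2
      ⟨(W.erase w₀).image (g ∘ Equiv.swap w₀ w₁), ?_, ?_⟩)
    · refine mem_transversals.2 ⟨_, hinj.mono (by simp), fun w hw => ?_, rfl⟩
      obtain ⟨hne, hw⟩ := mem_erase.1 hw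
      refine mem_erase.2 ⟨fun h => hne (hinj hw hw₀ (h.trans hval.symm)), ?_⟩
      by_cases h1 : w = w₁
      · subst h1
        simpa [hB] using hg w₀ hw₀
      · simpa [Equiv.swap_apply_of_ne_of_ne hne h1] using hg w hw
    · rw [← hval, ← image_insert, insert_erase hw₀, himg]
  · refine mem_union_right _ (mem_transversals.2 ⟨g, hgi, fun w hw => mem_erase.2 ⟨?_, hg w hw⟩,
      rfl⟩)
    rintro rfl
    exact hys (mem_image_of_mem g hw)

/-- If the indices are sorted into types such that `B` depends only on the type and sets belonging
to different types are disjoint, then replacing `B` by sets `A` that are at least as large and still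
disjoint for different types does not decrease the number of sets of distinct representatives. -/
theorem card_transversals_le_card_transversals {τ : Type*} (t : ι → τ) (W : Finset ι)
    (A B : ι → Finset ℕ)
    (hcard : ∀ w ∈ W, #(B w) ≤ #(A w))
    (hB : ∀ w ∈ W, ∀ w' ∈ W, t w = t w' → B w = B w')
    (hBt : ∀ w ∈ W, ∀ w' ∈ W, ∀ x, x ∈ B w → x ∈ B w' → t w = t w')
    (hAt : ∀ w ∈ W, ∀ w' ∈ W, ∀ x, x ∈ A w → x ∈ A w' → t w = t w') :
    #(transversals W B) ≤ #(transversals W A) := by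
  classical
  induction hn : ∑ w ∈ W, #(B w) using Nat.strong_induction_on generalizing W A B with
  | _ n ih =>
  subst hn
  rcases W.eq_empty_or_nonempty with rfl | ⟨w₀, hw₀⟩
  · rw [transversals_congr (A := A) (B := B) (by simp)]
  rcases (B w₀).eq_empty_or_nonempty with h0 | ⟨y, hy⟩
  · suffices transversals W B = ∅ by simp [this]
    refine eq_empty_of_forall_notMem fun s hs => ?_
    obtain ⟨g, -, hg, -⟩ := mem_transversals.1 hs
    simpa [h0] using hg w₀ hw₀
  obtain ⟨x, hx⟩ : (A w₀).Nonempty :=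
    card_pos.1 ((card_pos.2 ⟨y, hy⟩).trans_le (hcard w₀ hw₀))
  refine (card_transversals_le_erase_add hw₀ fun w hw hyw =>
    hB w hw w₀ hw₀ (hBt w hw w₀ hw₀ y hyw hy)).trans (le_trans (Nat.add_le_add ?_ ?_)
      (card_transversals_erase_add_le hw₀ hx))
  -- If `x ∈ A w`, then `w` has the type of `w₀`, so `y ∈ B w`: `A w` loses an element only when `B
  -- w` does.
  all_goals
    have hcard' : ∀ w ∈ W, #((B w).erase y) ≤ #((A w).erase x) := by
      intro w hw
      by_cases hxw : x ∈ A w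
      · have hyw : y ∈ B w := by
          rw [hB w hw w₀ hw₀ (hAt w hw w₀ hw₀ x hxw hx)]; exact hy
        rw [card_erase_of_mem hxw, card_erase_of_mem hyw]
        exact Nat.sub_le_sub_right (hcard w hw) 1
      · rw [erase_eq_of_notMem hxw]
        exact (card_erase_le).trans (hcard w hw)
  · refine ih _ ?_ _ _ _ (fun w hw => hcard' w (mem_of_mem_erase hw))
      (fun w hw w' hw' h => by rw [hB w (mem_of_mem_erase hw) w' (mem_of_mem_erase hw') h])
      (fun w hw w' hw' z h h' => hBt w (mem_of_mem_erase hw) w' (mem_of_mem_erase hw') z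
        (mem_of_mem_erase h) (mem_of_mem_erase h'))
      (fun w hw w' hw' z h h' => hAt w (mem_of_mem_erase hw) w' (mem_of_mem_erase hw') z
        (mem_of_mem_erase h) (mem_of_mem_erase h')) rfl
    rw [← add_sum_erase W _ hw₀]
    have h1 : ∑ w ∈ W.erase w₀, #((B w).erase y) ≤ ∑ w ∈ W.erase w₀, #(B w) :=
      sum_le_sum fun w _ => card_erase_le
    have h2 : 0 < #(B w₀) := card_pos.2 ⟨y, hy⟩
    omega
  · refine ih _ ?_ _ _ _ hcard' (fun w hw w' hw' h => by rw [hB w hw w' hw' h])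
      (fun w hw w' hw' z h h' => hBt w hw w' hw' z (mem_of_mem_erase h) (mem_of_mem_erase h'))
      (fun w hw w' hw' z h h' => hAt w hw w' hw' z (mem_of_mem_erase h) (mem_of_mem_erase h')) rfl
    exact sum_lt_sum (fun w _ => card_erase_le) ⟨w₀, hw₀, card_erase_lt_of_mem hy⟩

end Transversals

theorem exists_bijOn_of_map_eq {ι κ β : Type*} (t : ι → β) (t' : κ → β) (s : Finset ι)
    (s' : Finset κ) (h : s.val.map t = s'.val.map t') [Nonempty κ] :
    ∃ e : ι → κ, Set.BijOn e s s' ∧ ∀ w ∈ s, t' (e w) = t w := by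
  classical
  induction s using Finset.induction_on generalizing s' with
  | empty =>
    have : s' = ∅ := by simpa using h.symm
    subst this
    exact ⟨fun _ => Classical.arbitrary κ, by simp, by simp⟩
  | insert a s ha ih =>
    rw [insert_val_of_notMem ha, Multiset.map_cons] at h
    obtain ⟨b, hb, hba⟩ := Multiset.mem_map.1 (h ▸ Multiset.mem_cons_self (t a) _)
    have hb' : b ∈ s' := hb
    have hs' : insert b (s'.erase b) = s' := insert_erase hb'
    rw [← hs', insert_val_of_notMem (notMem_erase b s'), Multiset.map_cons, hba,
      Multiset.cons_inj_right] at h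
    obtain ⟨e, he, het⟩ := ih _ h
    have hea : ∀ w ∈ s, Function.update e a b w = e w := fun w hw =>
      Function.update_of_ne (ne_of_mem_of_not_mem hw ha) _ _
    refine ⟨Function.update e a b, ?_, ?_⟩
    · rw [← hs', coe_insert, coe_insert]
      have : Set.BijOn (Function.update e a b) s (s'.erase b : Finset κ) :=
        he.congr fun w hw => (hea w hw).symm
      have := this.insert (a := a) (by simp)
      simpa using this
    · intro w hw
      rcases mem_insert.1 hw with rfl | hw
      · rw [Function.update_self, hba]
      · rw [hea w hw, het w hw]

end Representatives

/-! ### Centers and rootings of trees -/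

namespace SimpleGraph

variable {V : Type*} {T : SimpleGraph V}

/-- Every vertex of a tree strictly between `r` and `s` is closer to any vertex `v` than `r` is or
closer than `s` is. -/
theorem IsTree.dist_lt_or_dist_lt (hT : T.IsTree) {r s x : V} {p : T.Walk r s} (hp : p.IsPath)
    (hx : x ∈ p.support) (hr : x ≠ r) (hs : x ≠ s) (v : V) :
    T.dist v x < T.dist v r ∨ T.dist v x < T.dist v s := by
  classical
  have key : ∀ {a : V} (q : T.Walk v a), q.length = T.dist v a → x ≠ a → x ∈ q.support →
      T.dist v x < T.dist v a := by
    intro a q hq hxa hxq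
    have h := congrArg Walk.length (q.take_spec hxq)
    rw [Walk.length_append] at h
    have h1 := dist_le (q.takeUntil x hxq)
    have h2 : (q.dropUntil x hxq).length ≠ 0 := fun h0 => hxa (Walk.eq_of_length_eq_zero h0)
    omega
  obtain ⟨q₁, hq₁⟩ := hT.connected.exists_walk_length_eq_dist v r
  obtain ⟨q₂, hq₂⟩ := hT.connected.exists_walk_length_eq_dist v s
  -- Paths in a tree are unique, so `p` runs inside the union of the geodesics from `v` to `r` and
  -- to `s`.
  have hpath : p = (q₁.reverse.append q₂).bypass :=
    (hT.existsUnique_path r s).unique hp (Walk.bypass_isPath _)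
  rw [hpath] at hx
  have hx' := Walk.support_bypass_subset_support _ hx
  rw [Walk.mem_support_append_iff, Walk.support_reverse, List.mem_reverse] at hx'
  exact hx'.imp (key q₁ hq₁ hr) (key q₂ hq₂ hs)

theorem Iso.dist_map (σ : T ≃g T) (hT : T.Connected) (u v : V) :
    T.dist (σ u) (σ v) = T.dist u v := by
  have key : ∀ (τ : T ≃g T) (u v : V), T.dist (τ u) (τ v) ≤ T.dist u v := by
    intro τ u v
    obtain ⟨q, hq⟩ := hT.exists_walk_length_eq_dist u v
    rw [← hq, ← Walk.length_map τ.toHom q]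
    exact dist_le _
  refine le_antisymm (key σ u v) ?_
  simpa using key σ.symm (σ u) (σ v)

/-- A finite tree has a vertex that every automorphism fixes or moves to a neighbor. -/
theorem IsTree.exists_forall_iso_eq_or_adj [Finite V] (hT : T.IsTree) :
    ∃ r : V, ∀ σ : T ≃g T, σ r = r ∨ T.Adj r (σ r) := by
  classical
  have := Fintype.ofFinite V
  have := hT.connected.nonempty
  -- A vertex of least eccentricity works: `σ r` has the same eccentricity, so an inner vertex of
  -- the path from `r` to `σ r` would have a smaller one.
  let ecc : V → ℕ := fun x => Finset.univ.sup fun v => T.dist v x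
  obtain ⟨r, hr⟩ := Finite.exists_min ecc
  refine ⟨r, fun σ => or_iff_not_imp_left.2 fun hne => by_contra fun hadj => ?_⟩
  have hecc : ecc (σ r) = ecc r := by
    refine le_antisymm (Finset.sup_le fun v _ => ?_) (hr _)
    have h := Iso.dist_map σ hT.connected (σ.symm v) r
    rw [RelIso.apply_symm_apply] at h
    rw [h]
    exact Finset.le_sup (f := fun v => T.dist v r) (Finset.mem_univ _)
  obtain ⟨p, hp, hpl⟩ := hT.connected.exists_path_of_dist r (σ r)
  have hlen : 1 < p.length := by
    rw [hpl]
    exact hT.connected.one_lt_dist_of_ne_of_not_adj (Ne.symm hne) hadj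
  have hnil : ¬ p.Nil := by
    intro h
    rw [← Walk.length_eq_zero_iff] at h
    omega
  have hxr : p.snd ≠ r := (p.adj_snd hnil).ne'
  have hxs : p.snd ≠ σ r := fun h => hadj (h ▸ p.adj_snd hnil)
  have hlt : ecc p.snd < ecc r := by
    have hpos : 0 < ecc r := by
      have h1 := Finset.le_sup (f := fun v => T.dist v r) (Finset.mem_univ (σ r))
      have h2 := hT.connected.pos_dist_of_ne hne
      exact h2.trans_le h1
    refine (Finset.sup_lt_iff hpos).2 fun v _ => ?_
    have h1 := Finset.le_sup (f := fun v => T.dist v r) (Finset.mem_univ v)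
    have h2 := Finset.le_sup (f := fun v => T.dist v (σ r)) (Finset.mem_univ v)
    rcases hT.dist_lt_or_dist_lt hp (p.getVert_mem_support 1) hxr hxs v with h | h
    · exact h.trans_le h1
    · exact (h.trans_le h2).trans_le hecc.le
  exact absurd (hr p.snd) (not_le.2 hlt)

/-- A root of a vertex set together with a parent map and a depth function. The parent of the root
is irrelevant. -/
structure Rooting (V : Type*) where
  /-- The root. -/
  root : V
  /-- The parent of a vertex other than the root. -/
  parent : V → V
  /-- The depth of a vertex. -/
  depth : V → ℕ
  depth_eq : ∀ v, v ≠ root → depth v = depth (parent v) + 1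

/-- The edges of `T` are the pairs that consist of a vertex and its parent. -/
def Rooting.Fits (R : Rooting V) (T : SimpleGraph V) : Prop :=
  ∀ u v, T.Adj u v ↔ (u ≠ R.root ∧ R.parent u = v) ∨ (v ≠ R.root ∧ R.parent v = u)

theorem IsTree.exists_rooting (hT : T.IsTree) (r : V) :
    ∃ R : Rooting V, R.root = r ∧ R.Fits T := by
  classical
  have hex : ∀ v, ∃ u, v ≠ r → T.Adj v u ∧ T.dist r v = T.dist r u + 1 := by
    intro v
    by_cases hv : v = r
    · exact ⟨v, fun h => absurd hv h⟩
    obtain ⟨p, hp⟩ := hT.connected.exists_walk_length_eq_dist v r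
    have hnil : ¬ p.Nil := fun h => hv h.eq
    refine ⟨p.snd, fun _ => ⟨p.adj_snd hnil, ?_⟩⟩
    have h1 := p.length_tail_add_one hnil
    have h2 := dist_le p.tail
    rw [dist_comm] at h2
    rw [dist_comm] at hp
    have h3 := hT.dist_eq_dist_add_one_of_adj r (p.adj_snd hnil)
    omega
  choose par hpar using hex
  -- Two neighbors of `v` closer to `r` would begin two different paths from `v` to `r`.
  have huniq : ∀ v u, T.Adj v u → T.dist r v = T.dist r u + 1 → par v = u := by
    intro v u hadj hd
    have hv : v ≠ r := by
      rintro rfl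
      simp at hd
    have path : ∀ w, T.Adj v w → T.dist r v = T.dist r w + 1 →
        ∃ p : T.Walk v r, p.IsPath ∧ p.snd = w := by
      intro w hw hdw
      obtain ⟨q, hq, hql⟩ := hT.connected.exists_path_of_dist w r
      refine ⟨.cons hw q, (Walk.cons_isPath_iff _ _).2 ⟨hq, fun hmem => ?_⟩, by simp⟩
      have h1 := congrArg Walk.length (q.take_spec hmem)
      rw [Walk.length_append, hql] at h1
      have h2 := dist_le (q.dropUntil v hmem)
      rw [dist_comm] at h1 h2
      omega
    obtain ⟨p, hp, hpu⟩ := path u hadj hd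
    obtain ⟨q, hq, hqu⟩ := path (par v) (hpar v hv).1 (hpar v hv).2
    rw [← hpu, ← hqu, (hT.existsUnique_path v r).unique hp hq]
  refine ⟨⟨r, par, T.dist r, fun v hv => (hpar v hv).2⟩, rfl, fun u v => ⟨fun h => ?_, ?_⟩⟩
  · rcases hT.dist_eq_dist_add_one_of_adj r h with h' | h'
    · refine .inl ⟨?_, huniq u v h h'⟩
      rintro rfl
      simp at h'
    · refine .inr ⟨?_, huniq v u h.symm h'⟩
      rintro rfl
      simp at h'
  · rintro (⟨hne, rfl⟩ | ⟨hne, rfl⟩)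
    · exact (hpar u hne).1
    · exact (hpar v hne).1.symm

end SimpleGraph

/-! ### Codes of colored rooted trees, and automorphisms -/

namespace SimpleGraph

/-- A natural number that represents a color together with a multiset of natural numbers. -/
noncomputable def nodeCode (p : ℕ × Multiset ℕ) : ℕ := Encodable.encode p

theorem nodeCode_injective : Function.Injective nodeCode := Encodable.encode_injective

theorem nodeCode_inj {c d : ℕ} {M N : Multiset ℕ} :
    nodeCode (c, M) = nodeCode (d, N) ↔ c = d ∧ M = N := by
  rw [nodeCode_injective.eq_iff, Prod.mk.injEq]

/-- The color stored in a node code. -/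
noncomputable def nodeColor (n : ℕ) : ℕ := (Function.invFun nodeCode n).1

@[simp] theorem nodeColor_nodeCode (c : ℕ) (M : Multiset ℕ) : nodeColor (nodeCode (c, M)) = c := by
  rw [nodeColor, Function.leftInverse_invFun nodeCode_injective]

namespace Rooting

variable {V : Type*}

/-- Recursion from the root towards the leaves. -/
theorem exists_topDown (R : Rooting V) {α : Type*} (x : α) (step : V → α → α) :
    ∃ a : V → α, a R.root = x ∧ ∀ v, v ≠ R.root → a v = step v (a (R.parent v)) := by
  classical
  -- The first argument is fuel. The root may have nonzero depth, so the recursion is stopped by the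
  -- test for the root.
  let F : ℕ → V → α := fun n => Nat.rec (fun _ => x)
    (fun _ f v => if v = R.root then x else step v (f (R.parent v))) n
  have hF : ∀ n v, F (n + 1) v = if v = R.root then x else step v (F n (R.parent v)) :=
    fun _ _ => rfl
  refine ⟨fun v => F (R.depth v + 1) v, by simp [hF], fun v hv => ?_⟩
  show F (R.depth v + 1) v = step v (F (R.depth (R.parent v) + 1) (R.parent v))
  rw [hF, if_neg hv, R.depth_eq v hv]

theorem induction_topDown (R : Rooting V) {P : V → Prop} (root : P R.root)
    (step : ∀ v, v ≠ R.root → P (R.parent v) → P v) (v : V) : P v := by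
  induction hn : R.depth v using Nat.strong_induction_on generalizing v with
  | _ n ih =>
  by_cases hv : v = R.root
  · exact hv ▸ root
  · have := R.depth_eq v hv
    exact step v hv (ih _ (by omega) _ rfl)

/-- If `σ` reversed the edge from `v` to its parent, induction from the root would make `v` its own
grandparent, against the depths. -/
theorem Fits.parent_iso {R : Rooting V} {T : SimpleGraph V} (hR : R.Fits T) (σ : T ≃g T) (hσ : σ R.root = R.root) (v : V)
    (hv : v ≠ R.root) : R.parent (σ v) = σ (R.parent v) := by
  have hne : ∀ u, u ≠ R.root → σ u ≠ R.root := fun u hu h =>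
    hu (σ.injective (h.trans hσ.symm))
  have hadj : ∀ u, u ≠ R.root → T.Adj (σ u) (σ (R.parent u)) := fun u hu =>
    σ.map_adj_iff.2 ((hR _ _).2 (.inl ⟨hu, rfl⟩))
  revert hv
  refine R.induction_topDown (P := fun v => v ≠ R.root → R.parent (σ v) = σ (R.parent v))
    (fun h => absurd rfl h) (fun v hv ih _ => ?_) v
  rcases (hR _ _).1 (hadj v hv) with ⟨-, h⟩ | ⟨h, h'⟩
  · exact h
  · have hp : R.parent v ≠ R.root := fun h0 => h (by rw [h0, hσ])
    have h1 := σ.injective ((ih hp).symm.trans h')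
    have h2 := R.depth_eq v hv
    have h3 := R.depth_eq _ hp
    rw [h1] at h3
    omega

variable [Fintype V] (R : Rooting V)

open scoped Classical in
/-- The children of a vertex. -/
noncomputable def children (v : V) : Finset V :=
  Finset.univ.filter fun w => w ≠ R.root ∧ R.parent w = v

variable {R} in
theorem mem_children {v w : V} : w ∈ R.children v ↔ w ≠ R.root ∧ R.parent w = v := by
  simp [children]

variable {R} in
theorem depth_of_mem_children {v w : V} (h : w ∈ R.children v) : R.depth w = R.depth v + 1 := by
  obtain ⟨hw, rfl⟩ := mem_children.1 h
  exact R.depth_eq w hw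

theorem depth_le_sup (v : V) : R.depth v ≤ Finset.univ.sup R.depth :=
  Finset.le_sup (Finset.mem_univ v)

theorem induction_bottomUp {P : V → Prop} (step : ∀ v, (∀ w ∈ R.children v, P w) → P v) (v : V) :
    P v := by
  induction hn : Finset.univ.sup R.depth - R.depth v using Nat.strong_induction_on
    generalizing v with
  | _ n ih =>
  refine step v fun w hw => ih _ ?_ w rfl
  have := depth_of_mem_children hw
  have := R.depth_le_sup w
  omega

/-- The code of the colored subtree at a vertex, which determines it up to isomorphism. -/
noncomputable def code (f : V → ℕ) (v : V) : ℕ :=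
  nodeCode (f v, (R.children v).attach.val.map fun w => code f w.1)
termination_by Finset.univ.sup R.depth - R.depth v
decreasing_by
  have := depth_of_mem_children w.2
  have := R.depth_le_sup w.1
  omega

theorem code_eq (f : V → ℕ) (v : V) :
    R.code f v = nodeCode (f v, (R.children v).val.map (R.code f)) := by
  rw [code]
  exact congrArg (fun M => nodeCode (f v, M))
    (Multiset.attach_map_val' (R.children v).val (R.code f))

/-- In every vertex the subtrees at the children are pairwise non-isomorphic as colored trees. -/
def SiblingsDiffer (f : V → ℕ) : Prop :=
  ∀ v, Set.InjOn (R.code f) (R.children v)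

section Automorphisms

variable {R} {T : SimpleGraph V} {f : V → ℕ}

/-- Such a `σ` preserves codes. If it fixes the parent of `v`, then `v` and `σ v` are siblings with
equal codes, hence equal. -/
theorem Fits.eq_refl_of_siblingsDiffer (hR : R.Fits T) (hf : R.SiblingsDiffer f) (σ : T ≃g T)
    (hσ : σ R.root = R.root) (hσf : ∀ v, f (σ v) = f v) : σ = RelIso.refl T.Adj := by
  classical
  have hpar := hR.parent_iso σ hσ
  have hne : ∀ u, σ u = R.root ↔ u = R.root := fun u =>
    ⟨fun h => σ.injective (h.trans hσ.symm), fun h => by rw [h, hσ]⟩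
  have hch : ∀ v, R.children (σ v) = (R.children v).map σ.toEquiv.toEmbedding := by
    intro v
    ext w
    obtain ⟨w, rfl⟩ := σ.surjective w
    have : σ w ∈ (R.children v).map σ.toEquiv.toEmbedding ↔ w ∈ R.children v :=
      Finset.mem_map' σ.toEquiv.toEmbedding
    rw [this, mem_children, mem_children, Ne, hne]
    refine and_congr_right fun hw => ?_
    rw [hpar w hw, σ.injective.eq_iff]
  have hcode : ∀ v, R.code f (σ v) = R.code f v := by
    refine R.induction_bottomUp fun v ih => ?_
    rw [code_eq, code_eq, hσf, hch, Finset.map_val, Multiset.map_map]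
    congr 2
    exact Multiset.map_congr rfl fun w hw => ih w hw
  refine RelIso.ext fun v => ?_
  refine R.induction_topDown (P := fun v => σ v = v) hσ (fun v hv ih => ?_) v
  refine hf (R.parent v) (mem_children.2 ⟨(hne v).not.2 hv, ?_⟩) (mem_children.2 ⟨hv, rfl⟩)
    (hcode v)
  rw [hpar v hv, ih]

/-- From two siblings `u`, `w` with equal codes, a nontrivial automorphism is built downwards from
the root out of code-preserving bijections between sets of children. -/
theorem Fits.siblingsDiffer_of_isDistinguishing (hR : R.Fits T) (hf : T.IsDistinguishing f) :
    R.SiblingsDiffer f := by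
  classical
  intro v₀ u hu w hw huw
  by_contra hne
  have : Nonempty V := ⟨v₀⟩
  have hB : ∀ a b, ∃ e : V → V, R.code f a = R.code f b →
      Set.BijOn e (R.children a) (R.children b) ∧
        ∀ x ∈ R.children a, R.code f (e x) = R.code f x := by
    intro a b
    by_cases h : R.code f a = R.code f b
    · rw [code_eq, code_eq, nodeCode_inj] at h
      obtain ⟨e, he⟩ := exists_bijOn_of_map_eq _ _ _ _ h.2
      exact ⟨e, fun _ => he⟩
    · exact ⟨id, fun h' => absurd h' h⟩
  choose B hB using hB
  let B' : V → V → V → V := fun a b => if a = v₀ ∧ b = v₀ then Equiv.swap u w else B a b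
  have hB' : ∀ a b, R.code f a = R.code f b →
      Set.BijOn (B' a b) (R.children a) (R.children b) ∧
        ∀ x ∈ R.children a, R.code f (B' a b x) = R.code f x := by
    intro a b hab
    by_cases h : a = v₀ ∧ b = v₀
    · obtain ⟨rfl, rfl⟩ := h
      have hmaps : Set.MapsTo (Equiv.swap u w) (R.children b) (R.children b) := by
        intro x hx
        rw [Equiv.swap_apply_def]
        split_ifs <;> assumption
      simp only [B', and_self, if_true]
      refine ⟨⟨hmaps, (Equiv.swap u w).injective.injOn, fun x hx =>
        ⟨Equiv.swap u w x, hmaps hx, Equiv.swap_apply_self _ _ _⟩⟩, fun x _ => ?_⟩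
      rw [Equiv.swap_apply_def]
      split_ifs with h1 h2
      · rw [h1, huw]
      · rw [h2, huw]
      · rfl
    · simp only [B', if_neg h]
      exact hB a b hab
  obtain ⟨s, hs0, hs⟩ := R.exists_topDown R.root fun v b => B' (R.parent v) b v
  have hcode : ∀ v, R.code f (s v) = R.code f v := by
    refine R.induction_topDown (by rw [hs0]) fun v hv ih => ?_
    rw [hs v hv]
    exact (hB' _ _ ih.symm).2 v (mem_children.2 ⟨hv, rfl⟩)
  have hmem : ∀ v, v ≠ R.root → s v ≠ R.root ∧ R.parent (s v) = s (R.parent v) := by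
    intro v hv
    rw [hs v hv]
    exact mem_children.1 ((hB' _ _ (hcode _).symm).1.mapsTo (mem_children.2 ⟨hv, rfl⟩))
  have hinj : Function.Injective s := by
    intro x
    refine R.induction_topDown (P := fun x => ∀ ⦃y⦄, s x = s y → x = y) ?_ ?_ x
    · intro y hy
      by_contra h
      exact (hmem y (Ne.symm h)).1 (hy.symm.trans hs0)
    · intro x hx ih y hy
      have hy0 : y ≠ R.root := by
        rintro rfl
        exact (hmem x hx).1 (hy.trans hs0)
      have hp : R.parent x = R.parent y := ih (by rw [← (hmem x hx).2, ← (hmem y hy0).2, hy])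
      have hy' := hy
      rw [hs x hx, hs y hy0, ← hp] at hy'
      exact (hB' _ _ (hcode _).symm).1.injOn (mem_children.2 ⟨hx, rfl⟩)
        (mem_children.2 ⟨hy0, hp.symm⟩) hy'
  have hroot : ∀ v, s v ≠ R.root ↔ v ≠ R.root := fun v =>
    ⟨fun h h' => h (by rw [h', hs0]), fun h => (hmem v h).1⟩
  have hpar : ∀ x y, (s x ≠ R.root ∧ R.parent (s x) = s y) ↔ (x ≠ R.root ∧ R.parent x = y) := by
    intro x y
    rw [hroot]
    refine and_congr_right fun hx => ?_
    rw [(hmem x hx).2, hinj.eq_iff]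
  let σ : T ≃g T :=
    { toEquiv := Equiv.ofBijective s (Finite.injective_iff_bijective.1 hinj)
      map_rel_iff' := by
        intro x y
        show T.Adj (s x) (s y) ↔ T.Adj x y
        rw [hR, hR, hpar, hpar] }
  have hσ : σ = RelIso.refl T.Adj := by
    refine hf σ fun v => ?_
    have h := hcode v
    rw [code_eq, code_eq, nodeCode_inj] at h
    exact h.1
  have hsid : ∀ v, s v = v := fun v => congrArg (fun τ : T ≃g T => τ v) hσ
  -- Since `s` is the identity, it fixes `v₀`, so the swap was used on the children of `v₀` and
  -- sends `u` to `w`.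
  obtain ⟨hu0, hup⟩ := mem_children.1 hu
  have h := hs u hu0
  rw [hsid, hup, hsid] at h
  simp only [B', and_self, if_true, Equiv.swap_apply_left] at h
  exact hne h

end Automorphisms

end Rooting

end SimpleGraph

/-! ### Counting the codes available from lists -/

section ListCodes

open Finset

namespace SimpleGraph.Rooting

variable {V : Type*} [Fintype V] (R : Rooting V)

open scoped Classical in
/-- The codes of those proper colorings from the lists `L` of the subtree at `v` that give `v` the
color `c` and under which siblings never have isomorphic subtrees. -/
noncomputable def listCodes (L : V → Finset ℕ) (v : V) (c : ℕ) : Finset ℕ :=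
  (transversals (R.children v) fun w =>
    -- The membership test only serves the termination proof; `listCodes_eq` removes it.
    if _hw : w ∈ R.children v then ((L w).erase c).biUnion fun d => listCodes L w d else ∅).image
      fun s => nodeCode (c, s.val)
termination_by univ.sup R.depth - R.depth v
decreasing_by
  have := depth_of_mem_children _hw
  have := R.depth_le_sup w
  omega

theorem listCodes_eq (L : V → Finset ℕ) (v : V) (c : ℕ) :
    R.listCodes L v c = (transversals (R.children v) fun w =>
      ((L w).erase c).biUnion fun d => R.listCodes L w d).image fun s => nodeCode (c, s.val) := by
  rw [listCodes]
  congr 1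
  exact transversals_congr fun w hw => dif_pos hw

theorem card_listCodes (L : V → Finset ℕ) (v : V) (c : ℕ) :
    #(R.listCodes L v c) = #(transversals (R.children v) fun w =>
      ((L w).erase c).biUnion fun d => R.listCodes L w d) := by
  rw [listCodes_eq, card_image_of_injective]
  exact fun s s' h => val_injective (nodeCode_inj.1 h).2

variable {R}
variable {L L' : V → Finset ℕ} {v v' : V} {c c' a : ℕ}

theorem mem_listCodes : a ∈ R.listCodes L v c ↔
    ∃ g : V → ℕ, Set.InjOn g (R.children v) ∧
      (∀ w ∈ R.children v, ∃ d ∈ L w, d ≠ c ∧ g w ∈ R.listCodes L w d) ∧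
        a = nodeCode (c, (R.children v).val.map g) := by
  rw [listCodes_eq]
  simp only [mem_image, mem_transversals, mem_biUnion, mem_erase]
  constructor
  · rintro ⟨s, ⟨g, hg, hgm, rfl⟩, rfl⟩
    refine ⟨g, hg, fun w hw => ?_, by rw [image_val_of_injOn hg]⟩
    obtain ⟨d, ⟨h1, h2⟩, h3⟩ := hgm w hw
    exact ⟨d, h2, h1, h3⟩
  · rintro ⟨g, hg, hgm, rfl⟩
    refine ⟨_, ⟨g, hg, fun w hw => ?_, rfl⟩, by rw [image_val_of_injOn hg]⟩
    obtain ⟨d, h1, h2, h3⟩ := hgm w hw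
    exact ⟨d, ⟨h2, h1⟩, h3⟩

theorem nodeColor_of_mem_listCodes (h : a ∈ R.listCodes L v c) : nodeColor a = c := by
  obtain ⟨g, -, -, rfl⟩ := mem_listCodes.1 h
  exact nodeColor_nodeCode _ _

theorem code_mem_listCodes {T : SimpleGraph V} (hR : R.Fits T) {f : V → ℕ}
    (hf : ∀ u v, T.Adj u v → f u ≠ f v) (hd : R.SiblingsDiffer f) (hL : ∀ v, f v ∈ L v) (v : V) :
    R.code f v ∈ R.listCodes L v (f v) := by
  refine R.induction_bottomUp (P := fun v => R.code f v ∈ R.listCodes L v (f v))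
    (fun v ih => ?_) v
  rw [code_eq, mem_listCodes]
  exact ⟨_, hd v, fun w hw => ⟨f w, hL w, hf _ _ ((hR _ _).2 (.inl (mem_children.1 hw))), ih w hw⟩,
    rfl⟩

/-- A code can be decoded from the root downwards: it yields a code for each child, and the colors
stored in these codes form the coloring. -/
theorem exists_coloring_of_mem_listCodes {T : SimpleGraph V} (hR : R.Fits T) (hc : c ∈ L R.root)
    (ha : a ∈ R.listCodes L R.root c) :
    ∃ f : V → ℕ, (∀ u v, T.Adj u v → f u ≠ f v) ∧ R.SiblingsDiffer f ∧ ∀ v, f v ∈ L v := by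
  have hG : ∀ v b, ∃ g : V → ℕ, b ∈ R.listCodes L v (nodeColor b) →
      Set.InjOn g (R.children v) ∧ (∀ w ∈ R.children v, nodeColor (g w) ∈ L w ∧
        nodeColor (g w) ≠ nodeColor b ∧ g w ∈ R.listCodes L w (nodeColor (g w))) ∧
          b = nodeCode (nodeColor b, (R.children v).val.map g) := by
    intro v b
    by_cases h : b ∈ R.listCodes L v (nodeColor b)
    · obtain ⟨g, hg, hgm, hb⟩ := mem_listCodes.1 h
      refine ⟨g, fun _ => ⟨hg, fun w hw => ?_, hb⟩⟩
      obtain ⟨d, h1, h2, h3⟩ := hgm w hw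
      rw [nodeColor_of_mem_listCodes h3]
      exact ⟨h1, h2, h3⟩
    · exact ⟨fun _ => 0, fun h' => absurd h' h⟩
  choose G hG using hG
  obtain ⟨s, hs0, hs⟩ := R.exists_topDown a fun v b => G (R.parent v) b v
  have hmem : ∀ v, s v ∈ R.listCodes L v (nodeColor (s v)) := by
    refine R.induction_topDown ?_ fun v hv ih => ?_
    · rw [hs0, nodeColor_of_mem_listCodes ha]
      exact ha
    · rw [hs v hv]
      exact ((hG _ _ ih).2.1 v (mem_children.2 ⟨hv, rfl⟩)).2.2
  have hGs : ∀ v, ∀ w ∈ R.children v, G v (s v) w = s w := by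
    intro v w hw
    obtain ⟨hw0, rfl⟩ := mem_children.1 hw
    exact (hs w hw0).symm
  have hcode : ∀ v, R.code (fun v => nodeColor (s v)) v = s v := by
    refine R.induction_bottomUp fun v ih => ?_
    rw [(hG v _ (hmem v)).2.2, code_eq, nodeCode_inj]
    refine ⟨rfl, Multiset.map_congr rfl fun w hw => ?_⟩
    rw [ih w hw, hGs v w hw]
  have hne : ∀ v, v ≠ R.root → nodeColor (s v) ≠ nodeColor (s (R.parent v)) := by
    intro v hv
    have hv' : v ∈ R.children (R.parent v) := mem_children.2 ⟨hv, rfl⟩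
    have := ((hG _ _ (hmem (R.parent v))).2.1 v hv').2.1
    rwa [hGs _ v hv'] at this
  refine ⟨fun v => nodeColor (s v), fun u v h => ?_, fun v u hu w hw h => ?_, fun v => ?_⟩
  · rcases (hR u v).1 h with ⟨hu, rfl⟩ | ⟨hv, rfl⟩
    · exact hne u hu
    · exact (hne v hv).symm
  · rw [hcode, hcode] at h
    refine (hG v _ (hmem v)).1 hu hw ?_
    rw [hGs v u hu, hGs v w hw, h]
  · by_cases hv : v = R.root
    · subst hv
      show nodeColor (s R.root) ∈ _
      rwa [hs0, nodeColor_of_mem_listCodes ha]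
    · have hv' : v ∈ R.children (R.parent v) := mem_children.2 ⟨hv, rfl⟩
      have := ((hG _ _ (hmem (R.parent v))).2.1 v hv').1
      rwa [hGs _ v hv'] at this

variable (R) in
/-- The isomorphism type of the subtree at a vertex, without colors. -/
noncomputable def shape (v : V) : ℕ := R.code (fun _ => 0) v

theorem shape_eq_iff : R.shape v = R.shape v' ↔
    (R.children v).val.map R.shape = (R.children v').val.map R.shape := by
  rw [shape, shape, code_eq, code_eq, nodeCode_inj]
  exact and_iff_right rfl

/-- A code still determines the uncolored subtree, which makes the code sets of differently shaped
siblings disjoint. -/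
theorem shape_eq_of_mem_listCodes (h : a ∈ R.listCodes L v c) (h' : a ∈ R.listCodes L v' c') :
    R.shape v = R.shape v' := by
  have : Nonempty V := ⟨v⟩
  revert v' a c c'
  refine R.induction_bottomUp (P := fun v => ∀ {v' : V} {c c' a : ℕ}, a ∈ R.listCodes L v c →
    a ∈ R.listCodes L v' c' → R.shape v = R.shape v') (fun v ih => ?_) v
  intro v' c c' a h h'
  obtain ⟨g, -, hgm, rfl⟩ := mem_listCodes.1 h
  obtain ⟨g', -, hgm', h⟩ := mem_listCodes.1 h'
  obtain ⟨-, h⟩ := nodeCode_inj.1 h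
  obtain ⟨e, he, heg⟩ := exists_bijOn_of_map_eq _ _ _ _ h
  rw [shape_eq_iff]
  refine Multiset.map_eq_map_of_bij_of_nodup _ _ (R.children v).nodup (R.children v').nodup
    (fun w _ => e w) (fun w hw => he.mapsTo hw) (fun w hw w' hw' h => he.injOn hw hw' h)
    (fun w hw => ?_) (fun w hw => ?_)
  · obtain ⟨u, hu, rfl⟩ := he.surjOn hw
    exact ⟨u, hu, rfl⟩
  · obtain ⟨d, -, -, hd⟩ := hgm w hw
    obtain ⟨d', -, -, hd'⟩ := hgm' (e w) (he.mapsTo hw)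
    rw [heg w hw] at hd'
    exact ih w hw hd hd'

theorem listCodes_const_subset (U : Finset ℕ) (h : R.shape v = R.shape v') (c : ℕ) :
    R.listCodes (fun _ => U) v c ⊆ R.listCodes (fun _ => U) v' c := by
  have : Nonempty V := ⟨v⟩
  revert v' c
  refine R.induction_bottomUp (P := fun v => ∀ {v' : V}, R.shape v = R.shape v' → ∀ c : ℕ,
    R.listCodes (fun _ => U) v c ⊆ R.listCodes (fun _ => U) v' c) (fun v ih => ?_) v
  intro v' h c a ha
  obtain ⟨e, he, het⟩ := exists_bijOn_of_map_eq _ _ _ _ (shape_eq_iff.1 h.symm)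
  obtain ⟨g, hg, hgm, rfl⟩ := mem_listCodes.1 ha
  refine mem_listCodes.2 ⟨g ∘ e, hg.comp he.injOn he.mapsTo, fun w hw => ?_, ?_⟩
  · obtain ⟨d, h1, h2, h3⟩ := hgm (e w) (he.mapsTo hw)
    exact ⟨d, h1, h2, ih (e w) (he.mapsTo hw) (het w hw) d h3⟩
  · rw [nodeCode_inj]
    refine ⟨rfl, (Multiset.map_eq_map_of_bij_of_nodup _ _ (R.children v').nodup
      (R.children v).nodup (fun w _ => e w) (fun w hw => he.mapsTo hw)
      (fun w hw w' hw' h => he.injOn hw hw' h) (fun w hw => ?_) (fun w _ => rfl)).symm⟩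
    obtain ⟨u, hu, rfl⟩ := he.surjOn hw
    exact ⟨u, hu, rfl⟩

theorem card_biUnion_listCodes (D : Finset ℕ) :
    #(D.biUnion fun d => R.listCodes L v d) = ∑ d ∈ D, #(R.listCodes L v d) := by
  refine card_biUnion fun d _ d' _ hne => Finset.disjoint_left.2 fun x hx hx' => hne ?_
  rw [← nodeColor_of_mem_listCodes hx, nodeColor_of_mem_listCodes hx']

/-- Constant lists minimize the number of codes among all lists that are at least as large. -/
theorem card_listCodes_const_le (U : Finset ℕ) (hL : ∀ v, #U ≤ #(L v)) (hc : c ∈ U) (c' : ℕ) :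
    #(R.listCodes (fun _ => U) v c) ≤ #(R.listCodes L v c') := by
  revert c c'
  refine R.induction_bottomUp (P := fun v => ∀ {c : ℕ}, c ∈ U → ∀ c' : ℕ,
    #(R.listCodes (fun _ => U) v c) ≤ #(R.listCodes L v c')) (fun v ih => ?_) v
  intro c hc c'
  rw [card_listCodes, card_listCodes]
  refine card_transversals_le_card_transversals R.shape _ _ _ (fun w hw => ?_)
    (fun w _ w' _ h => ?_) (fun w _ w' _ x hx hx' => ?_) (fun w _ w' _ x hx hx' => ?_)
  · rw [card_biUnion_listCodes, card_biUnion_listCodes]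
    -- As `c` and `c'` are independent in the induction hypothesis, even the largest count `m` for a
    -- color in `U` is at most the count for any color in `L w`.
    set m := U.sup fun d => #(R.listCodes (fun _ => U) w d) with hm
    calc ∑ d ∈ U.erase c, #(R.listCodes (fun _ => U) w d)
        ≤ #(U.erase c) • m := sum_le_card_nsmul _ _ _ fun d hd =>
          le_sup (f := fun d => #(R.listCodes (fun _ => U) w d)) (mem_of_mem_erase hd)
      _ ≤ #((L w).erase c') • m := by
          refine Nat.mul_le_mul_right m ?_
          rw [card_erase_of_mem hc]
          exact (Nat.sub_le_sub_right (hL w) 1).trans pred_card_le_card_erase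
      _ ≤ ∑ d ∈ (L w).erase c', #(R.listCodes L w d) :=
          card_nsmul_le_sum _ _ _ fun d _ => Finset.sup_le fun d' hd' => ih w hw hd' d
  · refine biUnion_congr rfl fun d _ => ?_
    exact (listCodes_const_subset U h d).antisymm (listCodes_const_subset U h.symm d)
  all_goals
    obtain ⟨d, -, hd⟩ := mem_biUnion.1 hx
    obtain ⟨d', -, hd'⟩ := mem_biUnion.1 hx'
    exact shape_eq_of_mem_listCodes hd hd'

end SimpleGraph.Rooting

/-! ### From colors to lists and back -/

namespace SimpleGraph

variable {V : Type*} {T : SimpleGraph V}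

theorem IsTree.properlyListDistinguishable [Finite V] (hT : T.IsTree) {k : ℕ}
    (hk : T.ProperlyDistinguishable k) {L : V → Finset ℕ} (hL : ∀ v, k ≤ #(L v)) :
    T.ProperlyListDistinguishable L := by
  have := Fintype.ofFinite V
  obtain ⟨C, hC⟩ := hk
  obtain ⟨r, hr⟩ := hT.exists_forall_iso_eq_or_adj
  obtain ⟨R, rfl, hR⟩ := hT.exists_rooting r
  let f : V → ℕ := fun v => C v
  have hf : T.IsDistinguishing f := fun σ hσ => hC σ fun v => Fin.ext (hσ v)
  have hcode := Rooting.code_mem_listCodes (L := fun _ => range k) hR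
    (fun u v h => Fin.val_ne_of_ne (C.valid h)) (hR.siblingsDiffer_of_isDistinguishing hf)
    (fun v => mem_range.2 (C v).2) R.root
  obtain ⟨c, hc⟩ : (L R.root).Nonempty := card_pos.1 ((C R.root).pos.trans_le (hL _))
  obtain ⟨a, ha⟩ : (R.listCodes L R.root c).Nonempty :=
    card_pos.1 ((card_pos.2 ⟨_, hcode⟩).trans_le (Rooting.card_listCodes_const_le (range k)
      (fun v => by rw [card_range]; exact hL v) (mem_range.2 (C R.root).2) c))
  obtain ⟨g, hg, hgd, hgL⟩ := Rooting.exists_coloring_of_mem_listCodes hR hc ha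
  refine ⟨Coloring.mk g fun {u v} h => hg u v h, fun σ hσ => ?_, hgL⟩
  refine hR.eq_refl_of_siblingsDiffer hgd σ ((hr σ).resolve_right fun h => ?_) hσ
  -- A color-preserving automorphism cannot move the root to a neighbor, because `g` is proper.
  exact hg _ _ h (hσ R.root).symm

theorem properlyDistinguishable_of_forall_list (G : SimpleGraph V) {k : ℕ}
    (h : ∀ L : V → Finset ℕ, (∀ v, k ≤ #(L v)) → G.ProperlyListDistinguishable L) :
    G.ProperlyDistinguishable k := by
  obtain ⟨C, hC, hCk⟩ := h (fun _ => range k) fun _ => (card_range k).ge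
  refine ⟨Coloring.mk (fun v => ⟨C v, mem_range.1 (hCk v)⟩) fun {u v} huv h =>
    C.valid huv (congrArg Fin.val h), fun σ hσ => hC σ fun v => congrArg Fin.val (hσ v)⟩

end SimpleGraph

end ListCodes

theorem theorem3 {V : Type*} [Finite V] (T : SimpleGraph V) (hT : T.IsTree) :
    T.distChromaticNumber = T.listDistChromaticNumber :=
  le_antisymm
    (T.isLeast_distChromaticNumber.2
      (T.properlyDistinguishable_of_forall_list T.isLeast_listDistChromaticNumber.1))
    (T.isLeast_listDistChromaticNumber.2 fun _ hL =>
      hT.properlyListDistinguishable T.isLeast_distChromaticNumber.1 hL)
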